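/- **Cascade bandit.** There are $K$ arms with trigger means $\mu_1,\dots,\mu_K$ and error probabilities $p_1<p_2<\dots<p_K$, where $0<\mu_i\le 1$ for all $i$ and $\mu_i<1$ for all $i<K$. In slot $t=1,2,\dots$ arm $i$ has an output $X_i(t)\in\{0,1\}$ with $\mathbb P(X_i(t)=1)=\mu_i$ and a feedback $Y_i(t)\in\{0,1\}$ with $\mathbb P(Y_i(t)=0\mid X_i(t)=1)=p_i$; the pairs $(X_i(t),Y_i(t))$ of one slot are independent over the arms $i$, and the outcomes of a slot are independent of everything that is known before that slot. At the start of slot $t$ the learner chooses, from the information available before slot $t$ (which may include auxiliary randomness), an ordering $\mathcal L_t=(l_1^{(t)},\dots,l_K^{(t)})$ of the arms. The arm $i$ with $X_i(t)=1$ all of whose predecessors in $\mathcal L_t$ output $0$, if there is one, is selected, and only its feedback $Y_i(t)$ is observed; it is the reward of the slot. The expected reward of an ordering $\mathcal L=(l_1,\dots,l_K)$ is $$r_{\mathcal L}=\sum_{i=1}^K(1-p_{l_i})\,\mu_{l_i}\prod_{j=1}^{i-1}(1-\mu_{l_j}),$$ and with $\mathcal L^*=(1,2,\dots,K)$, the ordering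 by increasing error probability, the expected regret is $\mathcal R(T)=\sum_{t=1}^T\mathbb E[\,r_{\mathcal L^*}-r_{\mathcal L_t}]$. **LCB algorithm.** Let $S_i(t)$ be the number of slots among $1,\dots,t$ in which feedback for arm $i$ is observed and, if $S_i(t)\ge1$, let $\hat p_i(t)$ be the fraction of those slots in which that feedback is $0$, and let $$L_i(t)=\hat p_i(t)-\sqrt{\frac{2\log t}{S_i(t)}}.$$ If $S_i(t)=0$ for some arm $i$, then an arm without feedback is put first in $\mathcal L_{t+1}$ (the rest of the ordering is arbitrary). Otherwise $\mathcal L_{t+1}$ lists the arms in ascending order of $L_i(t)$, with ties broken arbitrarily. **Theorem (LCB regret).** The LCB algorithm has expected regret $\mathcal R^{LCB}(T)=O(1)$: there is a constant $C$, depending only on $K$, $(\mu_i)$ and $(p_i)$, such that $|\mathcal R^{LCB}(T)|\le C$ for all $T\ge 0$, whatever probability space carries the outcomes and whatever choices are made where the algorithm leaves them open. -/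

import Mathlib

namespace CascadeBandit

open MeasureTheory ProbabilityTheory

/-- An ordering of the `K` arms, read as the map from positions to arms: `σ j` is the arm in
position `j` of the cascade, and `σ.symm i` is the position of arm `i`.
Arms and positions are numbered from `0`. -/
abbrev Ordering (K : ℕ) : Type := Equiv.Perm (Fin K)

/-- The expected reward of one slot played with the ordering `σ`, for trigger means `μ` and
error probabilities `p`. -/
noncomputable def reward {K : ℕ} (μ p : Fin K → ℝ) (σ : Ordering K) : ℝ :=
  ∑ i : Fin K, (1 - p (σ i)) * μ (σ i) * ∏ j ∈ Finset.univ.filter (fun j => j < i), (1 - μ (σ j))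

/-- If the arms output `x` in a slot in which they are ordered by `σ`, arm `i` is the selected arm:
it outputs one, and all arms preceding it in the cascade output zero. -/
def Selected {K : ℕ} (σ : Ordering K) (x : Fin K → Bool) (i : Fin K) : Prop :=
  x i = true ∧ ∀ j : Fin K, σ.symm j < σ.symm i → x j = false

instance {K : ℕ} (σ : Ordering K) (x : Fin K → Bool) (i : Fin K) : Decidable (Selected σ x i) :=
  inferInstanceAs (Decidable (_ ∧ _))

/-- The cascade bandit environment. Slots are numbered `t = 1, 2, …`; `X i t` is the output of
arm `i` in slot `t`, and `Y i t` is the user feedback to its response (`true` is one, `false` is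
zero). `ℱ t` is the information available after slot `t`, which may include auxiliary
randomness used to choose later orderings; the outcomes of a slot are independent of the information
available before that slot, and the arms are independent of each other within a slot. -/
structure IsEnvironment {K : ℕ} {Ω : Type*} [mΩ : MeasurableSpace Ω] (P : Measure Ω)
    (ℱ : Filtration ℕ mΩ) (μ p : Fin K → ℝ) (X Y : Fin K → ℕ → Ω → Bool) : Prop where
  measurable_output : ∀ (i : Fin K) (t : ℕ), 1 ≤ t → Measurable[ℱ t] (X i t)
  measurable_feedback : ∀ (i : Fin K) (t : ℕ), 1 ≤ t → Measurable[ℱ t] (Y i t)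
  indep_past : ∀ t : ℕ,
    Indep (MeasurableSpace.comap (fun ω => fun i : Fin K => (X i (t + 1) ω, Y i (t + 1) ω))
      inferInstance) (ℱ t) P
  indep_arms : ∀ t : ℕ, 1 ≤ t → iIndepFun (fun (i : Fin K) (ω : Ω) => (X i t ω, Y i t ω)) P
  output_mean : ∀ (i : Fin K) (t : ℕ), 1 ≤ t → P.real {ω | X i t ω = true} = μ i
  error_prob : ∀ (i : Fin K) (t : ℕ), 1 ≤ t →
    (P[|{ω | X i t ω = true}]).real {ω | Y i t ω = false} = p i

section Policy

variable {K : ℕ} {Ω : Type*} (X Y : Fin K → ℕ → Ω → Bool) (L : ℕ → Ω → Ordering K)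

/-- `S_i(t)`: the number of slots among `1, …, t` in which feedback for arm `i` is observed, when
`L s` is the ordering used in slot `s`. -/
def count (i : Fin K) (t : ℕ) (ω : Ω) : ℕ :=
  ((Finset.Icc 1 t).filter (fun s => Selected (L s ω) (fun j => X j s ω) i)).card

/-- The number of slots among `1, …, t` in which an error of arm `i` is observed. -/
def errorCount (i : Fin K) (t : ℕ) (ω : Ω) : ℕ :=
  ((Finset.Icc 1 t).filter
    (fun s => Selected (L s ω) (fun j => X j s ω) i ∧ Y i s ω = false)).card

/-- The empirical error probability of arm `i` after slot `t` (used only when `S_i(t) ≥ 1`). -/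
noncomputable def empError (i : Fin K) (t : ℕ) (ω : Ω) : ℝ :=
  (errorCount X Y L i t ω : ℝ) / (count X L i t ω : ℝ)

/-- The lower confidence bound of arm `i` after slot `t` (used only when `S_i(t) ≥ 1`). -/
noncomputable def lcb (i : Fin K) (t : ℕ) (ω : Ω) : ℝ :=
  empError X Y L i t ω - Real.sqrt (2 * Real.log (t : ℝ) / (count X L i t ω : ℝ))

/-- The orderings `L 1, L 2, …` are produced by the LCB algorithm. The ordering of a slot depends
only on information available before it. While some arm has not yet received any feedback, an arm
without feedback is pulled, that is, put first in the cascade (the remaining order is arbitrary);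
from then on, the arms are listed in ascending order of their current lower confidence bounds, with
ties broken arbitrarily. -/
structure IsLCB [mΩ : MeasurableSpace Ω] (ℱ : Filtration ℕ mΩ) : Prop where
  predictable : ∀ (t : ℕ) (σ : Ordering K), MeasurableSet[ℱ t] {ω | L (t + 1) ω = σ}
  initial : ∀ (t : ℕ) (ω : Ω), (∃ i : Fin K, count X L i t ω = 0) →
    ∃ i : Fin K, count X L i t ω = 0 ∧ (((L (t + 1) ω).symm i : Fin K) : ℕ) = 0
  ascending : ∀ (t : ℕ) (ω : Ω), (∀ i : Fin K, 1 ≤ count X L i t ω) →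
    Monotone (fun j : Fin K => lcb X Y L (L (t + 1) ω j) t ω)

end Policy

/-- The expected regret up to time `T` of playing `L t` in slot `t`, when the arms are indexed in
increasing order of their error probabilities, so that the optimal ordering is the identity. -/
noncomputable def regret {K : ℕ} {Ω : Type*} [MeasurableSpace Ω] (P : Measure Ω)
    (μ p : Fin K → ℝ) (L : ℕ → Ω → Ordering K) (T : ℕ) : ℝ :=
  ∑ t ∈ Finset.Icc 1 T, ∫ ω, (reward μ p (Equiv.refl (Fin K)) - reward μ p (L t ω)) ∂P

end CascadeBandit

namespace CascadeBandit

open MeasureTheory ProbabilityTheory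

section Supermartingale

open scoped ENNReal

variable {Ω : Type*} {mΩ : MeasurableSpace Ω} {P : Measure Ω} {ℱ : Filtration ℕ mΩ}
  {E ι : Type*} [MeasurableSpace E] [DiscreteMeasurableSpace E] [Finite ι]
  {ξ : ℕ → Ω → E} {A : ℕ → Ω → ι}

/-- A function of a finite-valued `a` and of `x`, as a measurable function of `x` and of an event
for `a`. -/
theorem measurable_comp_finite {m : MeasurableSpace Ω} {a : Ω → ι} {x : Ω → E}
    (ha : ∀ b, MeasurableSet (a ⁻¹' {b})) (hx : Measurable x) {β : Type*} [MeasurableSpace β]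
    (φ : ι → E → β) : Measurable fun ω => φ (a ω) (x ω) := by
  intro s _
  have : (fun ω => φ (a ω) (x ω)) ⁻¹' s = ⋃ b, a ⁻¹' {b} ∩ x ⁻¹' (φ b ⁻¹' s) := by
    ext ω; simp
  rw [this]
  exact MeasurableSet.iUnion fun b => (ha b).inter (hx (.of_discrete))

/-- Integrating out an outcome that is independent of the past. -/
theorem lintegral_mul_comp_le {m : MeasurableSpace Ω} (hm : m ≤ mΩ) {a : Ω → ι} {x : Ω → E}
    {Z : Ω → ℝ≥0∞} (hZ : Measurable[m] Z) (ha : ∀ b, MeasurableSet[m] (a ⁻¹' {b}))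
    (hx : Measurable[mΩ] x) (hind : Indep (MeasurableSpace.comap x inferInstance) m P)
    (φ : ι → E → ℝ≥0∞) (h1 : ∀ ω, ∫⁻ ω', φ (a ω) (x ω') ∂P ≤ 1) :
    ∫⁻ ω, Z ω * φ (a ω) (x ω) ∂P ≤ ∫⁻ ω, Z ω ∂P := by
  classical
  cases nonempty_fintype ι
  have hsum : ∀ f : ι → ℝ≥0∞, ∀ ω, f (a ω) = ∑ b, (a ⁻¹' {b}).indicator (fun _ => f b) ω := by
    intro f ω
    rw [Finset.sum_eq_single (a ω)]
    · simp
    · intro b _ hb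
      simp [Set.indicator, Ne.symm hb]
    · simp
  have hmeas : ∀ b, Measurable[m] fun ω => (a ⁻¹' {b}).indicator Z ω :=
    fun b => hZ.indicator (ha b)
  have h2 : ∀ b, ∫⁻ ω, (a ⁻¹' {b}).indicator Z ω * φ b (x ω) ∂P
      ≤ ∫⁻ ω, (a ⁻¹' {b}).indicator Z ω ∂P := by
    intro b
    have hφx : Measurable[MeasurableSpace.comap x inferInstance] fun ω => φ b (x ω) :=
      (Measurable.of_discrete (f := φ b)).comp (comap_measurable x)
    rw [lintegral_mul_eq_lintegral_mul_lintegral_of_independent_measurableSpace hm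
      hx.comap_le hind.symm (hmeas b) hφx]
    by_cases hb : ∃ ω, a ω = b
    · obtain ⟨ω, rfl⟩ := hb
      exact mul_le_of_le_one_right' (h1 ω)
    · have : a ⁻¹' {b} = ∅ := by
        ext ω; simpa using fun h => hb ⟨ω, h⟩
      simp [this]
  calc ∫⁻ ω, Z ω * φ (a ω) (x ω) ∂P
      = ∫⁻ ω, ∑ b, (a ⁻¹' {b}).indicator Z ω * φ b (x ω) ∂P := by
        refine lintegral_congr fun ω => ?_
        rw [hsum (fun b => φ b (x ω)) ω, Finset.mul_sum]
        refine Finset.sum_congr rfl fun b _ => ?_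
        by_cases h : ω ∈ a ⁻¹' {b} <;> simp [h]
    _ = ∑ b, ∫⁻ ω, (a ⁻¹' {b}).indicator Z ω * φ b (x ω) ∂P := by
        refine lintegral_finsetSum _ fun b _ => ?_
        exact ((hmeas b).mono hm le_rfl).mul ((Measurable.of_discrete (f := φ b)).comp hx)
    _ ≤ ∑ b, ∫⁻ ω, (a ⁻¹' {b}).indicator Z ω ∂P := Finset.sum_le_sum fun b _ => h2 b
    _ = ∫⁻ ω, ∑ b, (a ⁻¹' {b}).indicator Z ω ∂P := by
        rw [lintegral_finsetSum _ fun b _ => (hmeas b).mono hm le_rfl]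
    _ = ∫⁻ ω, Z ω ∂P := by
        refine lintegral_congr fun ω => ?_
        rw [Finset.sum_eq_single (a ω)]
        · simp
        · intro b _ hb
          simp [Set.indicator, Ne.symm hb]
        · simp

/-- Each outcome `ξ (t + 1)` is adapted and independent of the past `ℱ t`, and `A t` is a
finite-valued function of the past. -/
structure IsDriven (P : Measure Ω) (ℱ : Filtration ℕ mΩ) (ξ : ℕ → Ω → E) (A : ℕ → Ω → ι) :
    Prop where
  outcome : ∀ t, Measurable[ℱ (t + 1)] (ξ (t + 1))
  past : ∀ t b, MeasurableSet[ℱ t] (A t ⁻¹' {b})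
  indep : ∀ t, Indep (MeasurableSpace.comap (ξ (t + 1)) inferInstance) (ℱ t) P

theorem IsDriven.measurable_prod (h : IsDriven P ℱ ξ A) (φ : ι → E → ℝ≥0∞) (t : ℕ) :
    Measurable[ℱ t] fun ω => ∏ s ∈ Finset.range t, φ (A s ω) (ξ (s + 1) ω) := by
  induction t with
  | zero => simp
  | succ t ih =>
    simp only [Finset.prod_range_succ]
    refine (ih.mono (ℱ.mono t.le_succ) le_rfl).mul ?_
    exact measurable_comp_finite (fun b => ℱ.mono t.le_succ _ (h.past t b)) (h.outcome t) φ

theorem IsDriven.lintegral_prod_le_one [IsProbabilityMeasure P] (h : IsDriven P ℱ ξ A)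
    (φ : ι → E → ℝ≥0∞) (h1 : ∀ t ω, ∫⁻ ω', φ (A t ω) (ξ (t + 1) ω') ∂P ≤ 1) (t : ℕ) :
    ∫⁻ ω, ∏ s ∈ Finset.range t, φ (A s ω) (ξ (s + 1) ω) ∂P ≤ 1 := by
  induction t with
  | zero => simp
  | succ t ih =>
    simp only [Finset.prod_range_succ]
    exact (lintegral_mul_comp_le (ℱ.le t) (h.measurable_prod φ t) (h.past t)
      (show Measurable[mΩ] _ from (h.outcome t).mono (ℱ.le _) le_rfl) (h.indep t) φ (h1 t)).trans ih

/-- Markov's inequality for a product supermartingale. -/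
theorem IsDriven.measureReal_le_prod [IsProbabilityMeasure P] [Finite E] (h : IsDriven P ℱ ξ A)
    (φ : ι → E → ℝ) (h0 : ∀ a x, 0 ≤ φ a x)
    (h1 : ∀ t ω, ∫ ω', φ (A t ω) (ξ (t + 1) ω') ∂P ≤ 1) (t : ℕ) {c : ℝ} (hc : 0 < c) :
    P.real {ω | c ≤ ∏ s ∈ Finset.range t, φ (A s ω) (ξ (s + 1) ω)} ≤ c⁻¹ := by
  have h1' : ∀ t ω, ∫⁻ ω', ENNReal.ofReal (φ (A t ω) (ξ (t + 1) ω')) ∂P ≤ 1 := by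
    intro t ω
    have hmeas : Measurable fun ω' => φ (A t ω) (ξ (t + 1) ω') :=
      (Measurable.of_discrete (f := φ (A t ω))).comp ((h.outcome t).mono (ℱ.le _) le_rfl)
    obtain ⟨M, hM⟩ := (Set.finite_range (φ (A t ω))).bddAbove
    rw [← ofReal_integral_eq_lintegral_ofReal]
    · exact ENNReal.ofReal_le_one.2 (h1 t ω)
    · refine Integrable.of_bound hmeas.aestronglyMeasurable M (.of_forall fun ω' => ?_)
      rw [Real.norm_of_nonneg (h0 _ _)]
      exact hM ⟨_, rfl⟩
    · exact .of_forall fun ω' => h0 _ _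
  have h2 := h.lintegral_prod_le_one (fun a x => ENNReal.ofReal (φ a x)) h1' t
  have h3 := meas_ge_le_lintegral_div (μ := P)
    ((h.measurable_prod (fun a x => ENNReal.ofReal (φ a x)) t).mono (ℱ.le t) le_rfl).aemeasurable
    (ε := ENNReal.ofReal c) (by simpa using hc) ENNReal.ofReal_ne_top
  have h4 : {ω | c ≤ ∏ s ∈ Finset.range t, φ (A s ω) (ξ (s + 1) ω)}
      ⊆ {ω | ENNReal.ofReal c
        ≤ ∏ s ∈ Finset.range t, ENNReal.ofReal (φ (A s ω) (ξ (s + 1) ω))} := by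
    intro ω hω
    simp only [Set.mem_ofPred_eq] at hω ⊢
    rw [← ENNReal.ofReal_prod_of_nonneg fun _ _ => h0 _ _]
    exact ENNReal.ofReal_le_ofReal hω
  have h5 := ((measure_mono h4).trans h3).trans (ENNReal.div_le_div_right h2 _)
  rw [one_div, ← ENNReal.ofReal_inv_of_pos hc] at h5
  exact ENNReal.toReal_le_of_le_ofReal (inv_nonneg.2 hc.le) h5

/-- A Chernoff bound: if `V` has conditional probability at least `ε` in each slot in which `B`
holds, then it is unlikely that `B` holds often and `V` rarely. -/
theorem IsDriven.measureReal_rare_le [IsProbabilityMeasure P] [Finite E] (h : IsDriven P ℱ ξ A)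
    {ε : ℝ} (hε0 : 0 < ε) (hε1 : ε ≤ 1) (B : ι → Prop) [DecidablePred B]
    (V : ι → E → Prop) [∀ a, DecidablePred (V a)]
    (hV : ∀ t ω, B (A t ω) → ε ≤ P.real {ω' | V (A t ω) (ξ (t + 1) ω')}) (t n m : ℕ) :
    P.real {ω | n ≤ ((Finset.range t).filter fun s => B (A s ω)).card ∧
      ((Finset.range t).filter fun s => B (A s ω) ∧ V (A s ω) (ξ (s + 1) ω)).card ≤ m}
      ≤ 2 ^ m * (1 - ε / 2) ^ n := by
  set q : ℝ := 1 - ε / 2 with hq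
  have hq0 : 0 < q := by linarith
  have hq1 : q ≤ 1 := by linarith
  let φ : ι → E → ℝ := fun a x => (if B a then q⁻¹ else 1) * (if B a ∧ V a x then 2⁻¹ else 1)
  have hφ0 : ∀ a x, 0 ≤ φ a x := by
    intro a x
    simp only [φ]
    split_ifs <;> positivity
  have hφ1 : ∀ t ω, ∫ ω', φ (A t ω) (ξ (t + 1) ω') ∂P ≤ 1 := by
    intro t ω
    by_cases hB : B (A t ω)
    · have hms : MeasurableSet {ω' | V (A t ω) (ξ (t + 1) ω')} :=
        ((h.outcome t).mono (ℱ.le _) le_rfl) (.of_discrete (s := {x | V (A t ω) x}))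
      have : ∀ ω', φ (A t ω) (ξ (t + 1) ω') = q⁻¹ * (1 - 2⁻¹ *
          {ω' | V (A t ω) (ξ (t + 1) ω')}.indicator (fun _ => 1) ω') := by
        intro ω'
        by_cases hv : V (A t ω) (ξ (t + 1) ω') <;> simp [φ, hB, hv]
        norm_num
      simp only [this]
      rw [integral_const_mul, integral_sub (integrable_const _)
        (((integrable_const (1 : ℝ)).indicator hms).const_mul _), integral_const_mul,
        integral_indicator_const _ hms]
      have := hV t ω hB
      simp only [integral_const, probReal_univ, smul_eq_mul, mul_one]
      rw [inv_mul_le_iff₀ hq0]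
      linarith
    · simp [φ, hB]
  have hc : 0 < q⁻¹ ^ n * (2⁻¹ : ℝ) ^ m := by positivity
  have := h.measureReal_le_prod φ hφ0 hφ1 t hc
  rw [show (q⁻¹ ^ n * (2⁻¹ : ℝ) ^ m)⁻¹ = 2 ^ m * q ^ n by
    rw [mul_inv, ← inv_pow, ← inv_pow, inv_inv, inv_inv, mul_comm]] at this
  refine (measureReal_mono ?_).trans this
  rintro ω ⟨hn, hm⟩
  simp only [Set.mem_ofPred_eq, φ]
  rw [Finset.prod_mul_distrib, Finset.prod_ite, Finset.prod_ite]
  simp only [Finset.prod_const, one_pow, mul_one]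
  refine mul_le_mul ?_ ?_ (by positivity) (by positivity)
  · exact pow_le_pow_right₀ ((one_le_inv₀ hq0).2 hq1) hn
  · exact pow_le_pow_of_le_one (by norm_num) (by norm_num) hm

end Supermartingale

section Slot

variable {K : ℕ} {Ω : Type*}

/-- The outputs and feedbacks of all arms in one slot. -/
def outcome (X Y : Fin K → ℕ → Ω → Bool) (t : ℕ) (ω : Ω) : Fin K → Bool × Bool :=
  fun i => (X i t ω, Y i t ω)

/-- The arms that have received no feedback up to slot `t`. -/
def unseen (X : Fin K → ℕ → Ω → Bool) (L : ℕ → Ω → Ordering K) (t : ℕ) (ω : Ω) :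
    Finset (Fin K) :=
  Finset.univ.filter fun i => count X L i t ω = 0

/-- What the analysis uses of the information available before slot `t + 1`. -/
def state (X : Fin K → ℕ → Ω → Bool) (L : ℕ → Ω → Ordering K) (t : ℕ) (ω : Ω) :
    Ordering K × Finset (Fin K) :=
  (L (t + 1) ω, unseen X L t ω)

/-- Arm `i` is selected in a slot with ordering `σ` and outcome `x`. -/
def IsSelected (σ : Ordering K) (x : Fin K → Bool × Bool) (i : Fin K) : Prop :=
  Selected σ (fun j => (x j).1) i

instance (σ : Ordering K) (x : Fin K → Bool × Bool) (i : Fin K) : Decidable (IsSelected σ x i) :=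
  inferInstanceAs (Decidable (Selected _ _ _))

theorem card_filter_Icc_one (q : ℕ → Prop) [DecidablePred q] (t : ℕ) :
    ((Finset.Icc 1 t).filter q).card = ((Finset.range t).filter fun s => q (s + 1)).card := by
  rw [Finset.card_filter, Finset.card_filter]
  induction t with
  | zero => simp
  | succ t ih => rw [Finset.sum_Icc_succ_top (by omega), Finset.sum_range_succ, ih]

variable (X Y : Fin K → ℕ → Ω → Bool) (L : ℕ → Ω → Ordering K)

theorem count_eq_card (i : Fin K) (t : ℕ) (ω : Ω) :
    count X L i t ω = ((Finset.range t).filter fun s =>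
      IsSelected (state X L s ω).1 (outcome X Y (s + 1) ω) i).card :=
  card_filter_Icc_one _ t

theorem errorCount_eq_card (i : Fin K) (t : ℕ) (ω : Ω) :
    errorCount X Y L i t ω = ((Finset.range t).filter fun s =>
      IsSelected (state X L s ω).1 (outcome X Y (s + 1) ω) i ∧
        (outcome X Y (s + 1) ω i).2 = false).card :=
  card_filter_Icc_one _ t

theorem count_succ (i : Fin K) (t : ℕ) (ω : Ω) :
    count X L i (t + 1) ω = count X L i t ω +
      if IsSelected (state X L t ω).1 (outcome X Y (t + 1) ω) i then 1 else 0 := by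
  rw [count_eq_card X Y, count_eq_card X Y, Finset.range_add_one, Finset.filter_insert]
  split_ifs <;> simp

theorem count_le (i : Fin K) (t : ℕ) (ω : Ω) : count X L i t ω ≤ t := by
  refine (Finset.card_filter_le _ _).trans ?_
  simp

theorem count_mono (i : Fin K) (ω : Ω) : Monotone fun t => count X L i t ω :=
  monotone_nat_of_le_succ fun t => by rw [count_succ X X]; omega

variable {X Y L} [mΩ : MeasurableSpace Ω] {P : Measure Ω} {ℱ : Filtration ℕ mΩ} {μ p : Fin K → ℝ}

theorem IsEnvironment.measurable_outcome (hE : IsEnvironment P ℱ μ p X Y) (t : ℕ) :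
    Measurable[ℱ (t + 1)] (outcome X Y (t + 1)) :=
  @measurable_pi_lambda _ _ _ (ℱ (t + 1)) _ _ fun i =>
    (hE.measurable_output i (t + 1) (by omega)).prodMk
      (hE.measurable_feedback i (t + 1) (by omega))

theorem IsLCB.measurable_count (hE : IsEnvironment P ℱ μ p X Y) (hL : IsLCB X Y L ℱ)
    (i : Fin K) (t : ℕ) : Measurable[ℱ t] (count X L i t) := by
  induction t with
  | zero =>
    have : count X L i 0 = fun _ => 0 := by ext ω; simp [count]
    rw [this]
    exact measurable_const
  | succ t ih =>
    have : count X L i (t + 1) = fun ω => count X L i t ω +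
        if IsSelected (L (t + 1) ω) (outcome X Y (t + 1) ω) i then 1 else 0 :=
      funext fun ω => count_succ X Y L i t ω
    rw [this]
    exact (ih.mono (ℱ.mono t.le_succ) le_rfl).add <|
      measurable_comp_finite (fun σ => ℱ.mono t.le_succ _ (hL.predictable t σ))
        (hE.measurable_outcome t) fun σ x => if IsSelected σ x i then 1 else 0

theorem IsLCB.isDriven (hE : IsEnvironment P ℱ μ p X Y) (hL : IsLCB X Y L ℱ) :
    IsDriven P ℱ (outcome X Y) (state X L) where
  outcome := hE.measurable_outcome
  indep := hE.indep_past
  past t b := by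
    have : state X L t ⁻¹' {b} = {ω | L (t + 1) ω = b.1} ∩
        ⋂ i, count X L i t ⁻¹' {n | n = 0 ↔ i ∈ b.2} := by
      ext ω
      simp [state, unseen, Prod.ext_iff, Finset.ext_iff]
    rw [this]
    exact (hL.predictable t b.1).inter
      (MeasurableSet.iInter fun i => hL.measurable_count hE i t (.of_discrete))

theorem IsEnvironment.measureReal_prefix (hE : IsEnvironment P ℱ μ p X Y)
    [IsProbabilityMeasure P] (t : ℕ) (S : Finset (Fin K)) {i : Fin K} (hi : i ∉ S)
    (s : Set (Bool × Bool)) :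
    P.real {ω | outcome X Y (t + 1) ω i ∈ s ∧ ∀ j ∈ S, (outcome X Y (t + 1) ω j).1 = false} =
      P.real {ω | outcome X Y (t + 1) ω i ∈ s} * ∏ j ∈ S, (1 - μ j) := by
  classical
  have h := (hE.indep_arms (t + 1) (by omega)).measure_inter_preimage_eq_mul (insert i S)
    (sets := fun j => if j = i then s else {x | x.1 = false}) fun _ _ => .of_discrete
  have h1 : ⋂ j ∈ insert i S, (fun ω => (X j (t + 1) ω, Y j (t + 1) ω)) ⁻¹'
      (if j = i then s else {x | x.1 = false}) =
      {ω | outcome X Y (t + 1) ω i ∈ s ∧ ∀ j ∈ S, (outcome X Y (t + 1) ω j).1 = false} := by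
    ext ω
    simp only [Finset.mem_insert, Set.mem_iInter, Set.mem_preimage, forall_eq_or_imp, if_true,
      outcome, Set.mem_ofPred_eq]
    refine and_congr_right fun _ => forall₂_congr fun j hj => ?_
    rw [if_neg (by rintro rfl; exact hi hj)]
    rfl
  rw [h1] at h
  rw [Measure.real, h, ENNReal.toReal_prod, Finset.prod_insert hi, if_pos rfl]
  refine congrArg₂ _ rfl (Finset.prod_congr rfl fun j hj => ?_)
  rw [if_neg (by rintro rfl; exact hi hj)]
  have hms : MeasurableSet {ω | X j (t + 1) ω = true} :=
    ℱ.le _ _ (hE.measurable_output j (t + 1) (by omega) (.of_discrete (s := {true})))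
  rw [← hE.output_mean j (t + 1) (by omega), ← probReal_compl_eq_one_sub hms]
  refine congrArg P.real ?_
  ext ω
  simp

/-- The arms that precede arm `i` in the ordering `σ`. -/
def preceding (σ : Ordering K) (i : Fin K) : Finset (Fin K) :=
  Finset.univ.filter fun j => σ.symm j < σ.symm i

theorem isSelected_iff (σ : Ordering K) (x : Fin K → Bool × Bool) (i : Fin K) :
    IsSelected σ x i ↔ (x i).1 = true ∧ ∀ j ∈ preceding σ i, (x j).1 = false := by
  simp [IsSelected, Selected, preceding]

theorem notMem_preceding (σ : Ordering K) (i : Fin K) : i ∉ preceding σ i := by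
  simp [preceding]

theorem IsEnvironment.measureReal_isSelected (hE : IsEnvironment P ℱ μ p X Y)
    [IsProbabilityMeasure P] (t : ℕ) (σ : Ordering K) (i : Fin K) :
    P.real {ω | IsSelected σ (outcome X Y (t + 1) ω) i} =
      μ i * ∏ j ∈ preceding σ i, (1 - μ j) := by
  have h := hE.measureReal_prefix t _ (notMem_preceding σ i) {x | x.1 = true}
  have h2 : P.real {ω | outcome X Y (t + 1) ω i ∈ {x : Bool × Bool | x.1 = true}} = μ i :=
    hE.output_mean i (t + 1) (by omega)
  rw [h2] at h
  simp only [isSelected_iff]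
  exact h

theorem IsEnvironment.measureReal_isSelected_error (hE : IsEnvironment P ℱ μ p X Y)
    [IsProbabilityMeasure P] (hμ : ∀ i, 0 < μ i) (t : ℕ) (σ : Ordering K) (i : Fin K) :
    P.real {ω | IsSelected σ (outcome X Y (t + 1) ω) i ∧ (outcome X Y (t + 1) ω i).2 = false} =
      p i * P.real {ω | IsSelected σ (outcome X Y (t + 1) ω) i} := by
  have h := hE.measureReal_prefix t _ (notMem_preceding σ i) {x | x.1 = true ∧ x.2 = false}
  have hms : MeasurableSet {ω | X i (t + 1) ω = true} :=
    ℱ.le _ _ (hE.measurable_output i (t + 1) (by omega) (.of_discrete (s := {true})))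
  have h2 : P.real {ω | outcome X Y (t + 1) ω i ∈ {x : Bool × Bool | x.1 = true ∧ x.2 = false}} =
      p i * μ i := by
    rw [← hE.error_prob i (t + 1) (by omega), ← hE.output_mean i (t + 1) (by omega), Measure.real,
      Measure.real, Measure.real, cond_apply hms, ENNReal.toReal_mul, ENNReal.toReal_inv, mul_comm,
      mul_inv_cancel_left₀]
    · rfl
    · have := hE.output_mean i (t + 1) (by omega)
      rw [Measure.real] at this
      rw [this]
      exact (hμ i).ne'
  rw [h2] at h
  rw [hE.measureReal_isSelected, ← mul_assoc, ← h]
  refine congrArg P.real ?_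
  ext ω
  simp only [isSelected_iff, Set.mem_ofPred_eq]
  tauto

theorem IsEnvironment.pow_le_measureReal_isSelected (hE : IsEnvironment P ℱ μ p X Y)
    [IsProbabilityMeasure P] {ε : ℝ} (hε0 : 0 < ε) (hε1 : ε ≤ 1) (t : ℕ) {σ : Ordering K}
    {i : Fin K} (hi : ε ≤ μ i) (hpre : ∀ j ∈ preceding σ i, ε ≤ 1 - μ j) :
    ε ^ K ≤ P.real {ω | IsSelected σ (outcome X Y (t + 1) ω) i} := by
  rw [hE.measureReal_isSelected]
  have h1 : ε ^ (preceding σ i).card ≤ ∏ j ∈ preceding σ i, (1 - μ j) := by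
    rw [← Finset.prod_const]
    exact Finset.prod_le_prod (fun _ _ => hε0.le) hpre
  have h2 : (preceding σ i).card + 1 ≤ K := by
    rw [← Finset.card_insert_of_notMem (notMem_preceding σ i)]
    exact (Finset.card_le_univ _).trans (by simp)
  calc ε ^ K ≤ ε ^ ((preceding σ i).card + 1) := pow_le_pow_of_le_one hε0.le hε1 h2
    _ = ε * ε ^ (preceding σ i).card := pow_succ' _ _
    _ ≤ _ := mul_le_mul hi h1 (by positivity) (hε0.le.trans hi)

theorem IsEnvironment.error_prob_mem_Icc (hE : IsEnvironment P ℱ μ p X Y)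
    [IsProbabilityMeasure P] (i : Fin K) : p i ∈ Set.Icc 0 1 := by
  rw [← hE.error_prob i 1 le_rfl]
  refine ⟨measureReal_nonneg, ?_⟩
  exact (measureReal_mono (Set.subset_univ _)).trans measureReal_le_one

end Slot

/-- Hoeffding's lemma for a Bernoulli variable. -/
theorem bernoulli_mgf_le {p : ℝ} (hp : p ∈ Set.Icc (0 : ℝ) 1) (l : ℝ) :
    p * Real.exp (l * (1 - p)) + (1 - p) * Real.exp (-(l * p)) ≤ Real.exp (l ^ 2 / 8) := by
  let ν : Measure ℝ := ENNReal.ofReal p • Measure.dirac 1 + ENNReal.ofReal (1 - p) • Measure.dirac 0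
  have hν : IsProbabilityMeasure ν := by
    constructor
    simp only [ν, Measure.add_apply, Measure.smul_apply, measure_univ, smul_eq_mul, mul_one]
    rw [← ENNReal.ofReal_add hp.1 (by linarith [hp.2])]
    simp
  have hint : ∀ f : ℝ → ℝ, Measurable f → ∫ x, f x ∂ν = p * f 1 + (1 - p) * f 0 := by
    intro f hf
    have hd : ∀ (a : ℝ) (c : ℝ), Integrable f (ENNReal.ofReal c • Measure.dirac a) := fun a c =>
      (integrable_dirac (by simp)).smul_measure ENNReal.ofReal_ne_top
    rw [integral_add_measure (hd _ _) (hd _ _), integral_smul_measure, integral_smul_measure,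
      integral_dirac, integral_dirac, ENNReal.toReal_ofReal hp.1,
      ENNReal.toReal_ofReal (by linarith [hp.2])]
    rfl
  have hae : ∀ᵐ x ∂ν, x ∈ Set.Icc (0 : ℝ) 1 := by
    simp only [ν, ae_add_measure_iff]
    constructor <;> refine Measure.ae_smul_measure ?_ _ <;>
      rw [ae_dirac_eq] <;> simp
  have h := (hasSubgaussianMGF_of_mem_Icc (μ := ν) aemeasurable_id hae).mgf_le l
  rw [mgf, hint _ (by fun_prop)] at h
  have hmean : ∫ x, id x ∂ν = p := by rw [hint _ measurable_id]; simp
  simp only [hmean] at h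
  convert h using 2
  · simp
  · simp
  · norm_num
    ring

section Deviation

variable {K : ℕ} {Ω : Type*} [mΩ : MeasurableSpace Ω] {P : Measure Ω} [IsProbabilityMeasure P]
  {ℱ : Filtration ℕ mΩ} {μ p : Fin K → ℝ} {X Y : Fin K → ℕ → Ω → Bool} {L : ℕ → Ω → Ordering K}

theorem IsEnvironment.integral_exp_error_le (hE : IsEnvironment P ℱ μ p X Y) (hμ : ∀ i, 0 < μ i)
    (i : Fin K) (l : ℝ) (t : ℕ) (σ : Ordering K) :
    ∫ ω, Real.exp (if IsSelected σ (outcome X Y (t + 1) ω) i then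
      (if (outcome X Y (t + 1) ω i).2 = false then l * (1 - p i) else -(l * p i)) - l ^ 2 / 8
      else 0) ∂P ≤ 1 := by
  have hmeas : Measurable (outcome X Y (t + 1)) :=
    (hE.measurable_outcome t).mono (ℱ.le _) le_rfl
  set S := {ω | IsSelected σ (outcome X Y (t + 1) ω) i} with hS
  set S' := {ω | IsSelected σ (outcome X Y (t + 1) ω) i ∧ (outcome X Y (t + 1) ω i).2 = false}
    with hS'
  have hSm : MeasurableSet S := hmeas (.of_discrete (s := {x | IsSelected σ x i}))
  have hSm' : MeasurableSet S' :=
    hmeas (.of_discrete (s := {x | IsSelected σ x i ∧ (x i).2 = false}))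
  set a := Real.exp (l * (1 - p i) - l ^ 2 / 8) with ha
  set b := Real.exp (-(l * p i) - l ^ 2 / 8) with hb
  have hexp : ∀ ω, Real.exp (if IsSelected σ (outcome X Y (t + 1) ω) i then
      (if (outcome X Y (t + 1) ω i).2 = false then l * (1 - p i) else -(l * p i)) - l ^ 2 / 8
      else 0) = 1 + (S.indicator (fun _ => b - 1) ω + S'.indicator (fun _ => a - b) ω) := by
    intro ω
    by_cases h1 : IsSelected σ (outcome X Y (t + 1) ω) i <;>
      by_cases h2 : (outcome X Y (t + 1) ω i).2 = false <;> simp [hS, hS', h1, h2, ha, hb]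
  simp only [hexp]
  rw [integral_add (integrable_const _) (((integrable_const _).indicator hSm).add
    ((integrable_const _).indicator hSm')), integral_add ((integrable_const _).indicator hSm)
    ((integrable_const _).indicator hSm'), integral_indicator_const _ hSm,
    integral_indicator_const _ hSm', hE.measureReal_isSelected_error hμ t σ i]
  have hab : p i * a + (1 - p i) * b ≤ 1 := by
    have := mul_le_mul_of_nonneg_right (bernoulli_mgf_le (hE.error_prob_mem_Icc i) l)
      (Real.exp_pos (-(l ^ 2 / 8))).le
    rw [add_mul, mul_assoc, mul_assoc, ← Real.exp_add, ← Real.exp_add, ← Real.exp_add] at this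
    simpa [ha, hb, sub_eq_add_neg] using this
  have hs : 0 ≤ P.real S := measureReal_nonneg
  simp only [integral_const, probReal_univ, smul_eq_mul, mul_one]
  nlinarith [mul_nonneg hs (sub_nonneg.2 hab)]

theorem IsLCB.measureReal_error_sub_le (hE : IsEnvironment P ℱ μ p X Y) (hL : IsLCB X Y L ℱ)
    (hμ : ∀ i, 0 < μ i) (i : Fin K) (l u : ℝ) (t : ℕ) :
    P.real {ω | u + l ^ 2 / 8 * count X L i t ω ≤
      l * (errorCount X Y L i t ω - p i * count X L i t ω)} ≤ Real.exp (-u) := by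
  let φ : Ordering K × Finset (Fin K) → (Fin K → Bool × Bool) → ℝ := fun a x =>
    Real.exp (if IsSelected a.1 x i then
      (if (x i).2 = false then l * (1 - p i) else -(l * p i)) - l ^ 2 / 8 else 0)
  have h := (hL.isDriven hE).measureReal_le_prod φ (fun _ _ => (Real.exp_pos _).le)
    (fun t ω => hE.integral_exp_error_le hμ i l t _) t (Real.exp_pos u)
  rw [← Real.exp_neg] at h
  refine (measureReal_mono fun ω hω => ?_).trans h
  simp only [Set.mem_ofPred_eq, φ] at hω ⊢
  rw [← Real.exp_sum, Real.exp_le_exp]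
  rw [← sub_nonneg] at hω ⊢
  refine hω.trans_eq ?_
  rw [count_eq_card X Y, errorCount_eq_card, Finset.card_filter, Finset.card_filter]
  push_cast
  rw [sub_add_eq_sub_sub_swap, sub_left_inj, Finset.mul_sum, Finset.mul_sum,
    ← Finset.sum_sub_distrib, Finset.mul_sum, ← Finset.sum_sub_distrib]
  refine Finset.sum_congr rfl fun s _ => ?_
  by_cases h1 : IsSelected (state X L s ω).1 (outcome X Y (s + 1) ω) i <;>
    by_cases h2 : (outcome X Y (s + 1) ω i).2 = false <;> simp [h1, h2]

/-- The empirical error probability of arm `i` differs from `p i` by more than the confidence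
radius. -/
def Deviates (p : Fin K → ℝ) (X Y : Fin K → ℕ → Ω → Bool) (L : ℕ → Ω → Ordering K) (i : Fin K)
    (t : ℕ) (ω : Ω) : Prop :=
  1 ≤ count X L i t ω ∧
    Real.sqrt (2 * Real.log t / count X L i t ω) < |empError X Y L i t ω - p i|

theorem IsLCB.measureReal_deviates_le (hE : IsEnvironment P ℱ μ p X Y) (hL : IsLCB X Y L ℱ)
    (hμ : ∀ i, 0 < μ i) (i : Fin K) {t : ℕ} (ht : 1 ≤ t) :
    P.real {ω | Deviates p X Y L i t ω} ≤ 2 / (t : ℝ) ^ 3 := by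
  have ht0 : (0 : ℝ) < t := by exact_mod_cast ht
  have hlog : 0 ≤ Real.log t := Real.log_natCast_nonneg t
  let w : ℕ → ℝ := fun n => Real.sqrt (2 * Real.log t / n)
  let F : ℝ → Set Ω := fun l => {ω | 4 * Real.log t + l ^ 2 / 8 * count X L i t ω ≤
      l * (errorCount X Y L i t ω - p i * count X L i t ω)}
  have hF : ∀ l, P.real (F l) ≤ 1 / (t : ℝ) ^ 4 := by
    intro l
    refine (hL.measureReal_error_sub_le hE hμ i l _ t).trans_eq ?_
    rw [Real.exp_neg, show (4 : ℝ) * Real.log t = ((4 : ℕ) : ℝ) * Real.log t by norm_num,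
      Real.exp_nat_mul, Real.exp_log ht0, one_div]
  have hsub : {ω | Deviates p X Y L i t ω} ⊆
      ⋃ n ∈ Finset.Icc 1 t, F (4 * w n) ∪ F (-(4 * w n)) := by
    rintro ω ⟨h1, h2⟩
    refine Set.mem_biUnion (x := count X L i t ω)
      (by simpa using ⟨h1, count_le X L i t ω⟩) ?_
    set n := count X L i t ω with hn
    have hn0 : (0 : ℝ) < n := by exact_mod_cast h1
    have hw0 : 0 ≤ w n := Real.sqrt_nonneg _
    have hw2 : w n ^ 2 * n = 2 * Real.log t := by
      rw [Real.sq_sqrt (by positivity), div_mul_cancel₀ _ hn0.ne']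
    have herr : (empError X Y L i t ω - p i) * n = errorCount X Y L i t ω - p i * n := by
      rw [sub_mul, empError, ← hn, div_mul_cancel₀ _ hn0.ne']
    simp only [Set.mem_union, F, Set.mem_ofPred_eq, ← hn, ← herr]
    rcases lt_abs.1 h2 with h3 | h3
    · left
      have := mul_le_mul_of_nonneg_right h3.le (mul_nonneg hw0 hn0.le)
      change w n * (w n * n) ≤ _ at this
      linarith
    · right
      have := mul_le_mul_of_nonneg_right h3.le (mul_nonneg hw0 hn0.le)
      change w n * (w n * n) ≤ _ at this
      linarith
  calc P.real {ω | Deviates p X Y L i t ω}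
      ≤ P.real (⋃ n ∈ Finset.Icc 1 t, F (4 * w n) ∪ F (-(4 * w n))) :=
        measureReal_mono hsub (measure_ne_top _ _)
    _ ≤ ∑ n ∈ Finset.Icc 1 t, P.real (F (4 * w n) ∪ F (-(4 * w n))) :=
        measureReal_biUnion_finset_le _ _
    _ ≤ ∑ n ∈ Finset.Icc 1 t, 2 / (t : ℝ) ^ 4 := by
        refine Finset.sum_le_sum fun n _ => (measureReal_union_le _ _).trans ?_
        refine (add_le_add (hF _) (hF _)).trans_eq ?_
        ring
    _ = 2 / (t : ℝ) ^ 3 := by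
        rw [Finset.sum_const, Nat.card_Icc, nsmul_eq_mul]
        field_simp
        norm_num

end Deviation

/-- Constants of an instance: `ε` bounds the trigger means from below and, except for the arm
`last` with the largest error probability, away from one; `δ` bounds the gaps of the error
probabilities; and more than `D * log t` observations make the confidence radius less than `δ / 2`
in slot `t`. -/
structure IsSeparated {K : ℕ} (μ p : Fin K → ℝ) (last : Fin K) (ε δ : ℝ) (D : ℕ) : Prop where
  le_last : ∀ j, j ≤ last
  eps_pos : 0 < ε
  eps_le_one : ε ≤ 1
  eps_le : ∀ i, ε ≤ μ i
  eps_le_one_sub : ∀ j, j ≠ last → ε ≤ 1 - μ j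
  delta_pos : 0 < δ
  add_delta_le : ∀ i j, i < j → p i + δ ≤ p j
  eight_le : 8 ≤ D * δ ^ 2

section Confidence

variable {K : ℕ} {Ω : Type*} {μ p : Fin K → ℝ} {X Y : Fin K → ℕ → Ω → Bool}
  {L : ℕ → Ω → Ordering K} {last : Fin K} {ε δ : ℝ} {D : ℕ}

theorem card_feedback_unseen_le (X Y : Fin K → ℕ → Ω → Bool) (L : ℕ → Ω → Ordering K) (t : ℕ)
    (ω : Ω) (q : ℕ → Prop) [DecidablePred q]
    (hq : ∀ s, q s → ∃ i ∈ unseen X L s ω,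
      IsSelected (state X L s ω).1 (outcome X Y (s + 1) ω) i) :
    ((Finset.range t).filter q).card ≤ (unseen X L t ω)ᶜ.card := by
  induction t with
  | zero => simp
  | succ t ih =>
    have hsub : (unseen X L t ω)ᶜ ⊆ (unseen X L (t + 1) ω)ᶜ := by
      intro i
      have := count_mono X L i ω (Nat.le_add_right t 1)
      simp only [unseen, Finset.mem_compl, Finset.mem_filter, Finset.mem_univ, true_and]
      dsimp only at this
      omega
    rw [Finset.range_add_one, Finset.filter_insert]
    split_ifs with h
    · obtain ⟨i, hi, hsel⟩ := hq t h
      rw [Finset.card_insert_of_notMem (by simp)]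
      refine (Nat.succ_le_succ ih).trans (Finset.card_lt_card ⟨hsub, fun hc => ?_⟩)
      have hi' : i ∈ (unseen X L (t + 1) ω)ᶜ := by
        have := count_succ X Y L i t ω
        rw [if_pos hsel] at this
        simp [unseen, this]
      exact Finset.mem_compl.1 (hc hi') hi
    · exact ih.trans (Finset.card_le_card hsub)

theorem lcb_lt_lcb (hs : IsSeparated μ p last ε δ D) {i j : Fin K} (hij : i < j) {t : ℕ} {ω : Ω}
    (hi0 : count X L i t ω ≠ 0) (hi : ¬ Deviates p X Y L i t ω) (hj : ¬ Deviates p X Y L j t ω)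
    (hD : D * Real.log t < count X L j t ω) : lcb X Y L i t ω < lcb X Y L j t ω := by
  have hlog : 0 ≤ Real.log t := Real.log_natCast_nonneg t
  have hn : (0 : ℝ) < count X L j t ω := lt_of_le_of_lt (by positivity) hD
  have hi' : |empError X Y L i t ω - p i| ≤ Real.sqrt (2 * Real.log t / count X L i t ω) := by
    by_contra hc
    exact hi ⟨by omega, not_le.1 hc⟩
  have hj' : |empError X Y L j t ω - p j| ≤ Real.sqrt (2 * Real.log t / count X L j t ω) := by
    by_contra hc
    exact hj ⟨by exact_mod_cast hn, not_le.1 hc⟩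
  have hw : Real.sqrt (2 * Real.log t / count X L j t ω) < δ / 2 := by
    rw [Real.sqrt_lt' (by linarith [hs.delta_pos]), div_lt_iff₀ hn]
    have h1 := mul_lt_mul_of_pos_right hD (pow_pos hs.delta_pos 2)
    have h2 := mul_le_mul_of_nonneg_right hs.eight_le hlog
    nlinarith
  have hgap := hs.add_delta_le i j hij
  have h1 := (abs_le.1 hi').2
  have h2 := (abs_le.1 hj').1
  rw [lcb, lcb]
  linarith

end Confidence

section Counts

variable {K : ℕ} {Ω : Type*} [mΩ : MeasurableSpace Ω] {P : Measure Ω} {ℱ : Filtration ℕ mΩ}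
  {μ p : Fin K → ℝ} {X Y : Fin K → ℕ → Ω → Bool} {L : ℕ → Ω → Ordering K}
  {last : Fin K} {ε δ : ℝ} {D : ℕ}

theorem IsLCB.measureReal_count_le [IsProbabilityMeasure P] (hE : IsEnvironment P ℱ μ p X Y)
    (hL : IsLCB X Y L ℱ) (hs : IsSeparated μ p last ε δ D) (j : Fin K) (t n m : ℕ) :
    P.real {ω | n ≤ ((Finset.range t).filter fun s => last ∉ preceding (L (s + 1) ω) j).card ∧
      count X L j t ω ≤ m} ≤ 2 ^ m * (1 - ε ^ K / 2) ^ n := by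
  have h := (hL.isDriven hE).measureReal_rare_le (pow_pos hs.eps_pos K)
    (pow_le_one₀ hs.eps_pos.le hs.eps_le_one) (fun a => last ∉ preceding a.1 j)
    (fun a x => IsSelected a.1 x j) (fun t ω hB => ?_) t n m
  · refine le_trans (measureReal_mono (fun ω hω => ?_) (measure_ne_top _ _)) h
    refine ⟨?_, ?_⟩
    · exact hω.1
    · refine le_trans (Finset.card_le_card ?_) ((count_eq_card X Y L j t ω).symm.trans_le hω.2)
      intro s hs
      simp only [Finset.mem_filter] at hs ⊢
      exact ⟨hs.1, hs.2.2⟩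
  · refine hE.pow_le_measureReal_isSelected hs.eps_pos hs.eps_le_one t (hs.eps_le j) fun k hk => ?_
    refine hs.eps_le_one_sub k ?_
    rintro rfl
    exact hB hk

theorem IsLCB.measureReal_unseen_le [IsProbabilityMeasure P] (hE : IsEnvironment P ℱ μ p X Y)
    (hL : IsLCB X Y L ℱ) (hs : IsSeparated μ p last ε δ D) (t : ℕ) :
    P.real {ω | ∃ i, count X L i t ω = 0} ≤ 2 ^ K * (1 - ε ^ K / 2) ^ t := by
  have h := (hL.isDriven hE).measureReal_rare_le (pow_pos hs.eps_pos K)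
    (pow_le_one₀ hs.eps_pos.le hs.eps_le_one) (fun a => a.2.Nonempty)
    (fun a x => ∃ i ∈ a.2, IsSelected a.1 x i) (fun t ω hB => ?_) t t K
  · refine le_trans (measureReal_mono (fun ω hω => ?_) (measure_ne_top _ _)) h
    refine ⟨?_, ?_⟩
    · obtain ⟨i, hi⟩ := hω
      rw [Finset.filter_true_of_mem, Finset.card_range]
      intro s hs
      refine ⟨i, ?_⟩
      have := count_mono X L i ω (Finset.mem_range.1 hs).le
      simp only [state, unseen, Finset.mem_filter, Finset.mem_univ, true_and]
      dsimp only at this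
      omega
    · refine (card_feedback_unseen_le X Y L t ω _ fun s hs => hs.2).trans ?_
      exact (Finset.card_le_univ _).trans_eq (Fintype.card_fin K)
  · obtain ⟨i, hi⟩ := hB
    obtain ⟨k, hk, hk0⟩ := hL.initial t ω ⟨i, (Finset.mem_filter.1 hi).2⟩
    have hpre : preceding (L (t + 1) ω) k = ∅ := by
      refine Finset.filter_eq_empty_iff.2 fun j _ => ?_
      rw [Fin.lt_def, hk0]
      omega
    refine (hE.pow_le_measureReal_isSelected hs.eps_pos hs.eps_le_one t (σ := L (t + 1) ω)
      (hs.eps_le k) (by simp [hpre])).trans (measureReal_mono fun ω' hω' => ?_)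
    exact ⟨k, by simpa [state, unseen] using hk, hω'⟩

theorem IsLCB.symm_lt_symm (hL : IsLCB X Y L ℱ) {t : ℕ} {ω : Ω} (h0 : ∀ i, count X L i t ω ≠ 0)
    {i j : Fin K} (h : lcb X Y L i t ω < lcb X Y L j t ω) :
    (L (t + 1) ω).symm i < (L (t + 1) ω).symm j := by
  by_contra hc
  have := hL.ascending t ω (fun i => Nat.one_le_iff_ne_zero.2 (h0 i)) (not_lt.1 hc)
  simp only [Equiv.apply_symm_apply] at this
  exact absurd h (not_lt.2 this)

/-- After slot `t`, some arm has no feedback, or some estimate is outside its confidence interval,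
or the arm `last` has few observations. -/
def IsBad (p : Fin K → ℝ) (X Y : Fin K → ℕ → Ω → Bool) (L : ℕ → Ω → Ordering K) (last : Fin K)
    (D t : ℕ) (ω : Ω) : Prop :=
  (∃ i, count X L i t ω = 0) ∨ (∃ i, Deviates p X Y L i t ω) ∨
    (count X L last t ω : ℝ) ≤ D * Real.log t

theorem IsLCB.last_notMem_preceding (hL : IsLCB X Y L ℱ) (hs : IsSeparated μ p last ε δ D)
    {t : ℕ} {ω : Ω} (h : ¬ IsBad p X Y L last D t ω) (j : Fin K) :
    last ∉ preceding (L (t + 1) ω) j := by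
  simp only [IsBad, not_or, not_exists, not_le] at h
  obtain ⟨h0, hdev, hlast⟩ := h
  rcases (hs.le_last j).eq_or_lt with rfl | hj
  · exact notMem_preceding _ _
  · have := hL.symm_lt_symm h0 (lcb_lt_lcb hs hj (h0 j) (hdev j) (hdev last) hlast)
    simp [preceding, this.le]

theorem IsLCB.eq_refl (hL : IsLCB X Y L ℱ) (hs : IsSeparated μ p last ε δ D)
    {t : ℕ} {ω : Ω} (h : ¬ IsBad p X Y L last D t ω)
    (hD : ∀ j, D * Real.log t < count X L j t ω) : L (t + 1) ω = Equiv.refl (Fin K) := by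
  simp only [IsBad, not_or, not_exists, not_le] at h
  obtain ⟨h0, hdev, -⟩ := h
  have hmono : StrictMono (L (t + 1) ω).symm := fun i j hij =>
    hL.symm_lt_symm h0 (lcb_lt_lcb hs hij (h0 i) (hdev i) (hdev j) (hD j))
  have := Subsingleton.elim (hmono.orderIsoOfSurjective _ (Equiv.surjective _))
    (OrderIso.refl (Fin K))
  have h2 : (L (t + 1) ω).symm = Equiv.refl (Fin K) := Equiv.ext fun i => DFunLike.congr_fun this i
  rw [← Equiv.symm_symm (L (t + 1) ω), h2, Equiv.refl_symm]

end Counts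

theorem two_pow_floor_mul_log_le (D : ℕ) {t : ℕ} (ht : 1 ≤ t) :
    (2 : ℝ) ^ ⌊D * Real.log t⌋₊ ≤ (t : ℝ) ^ D := by
  have ht0 : (0 : ℝ) < t := by exact_mod_cast ht
  have hlog : 0 ≤ Real.log t := Real.log_natCast_nonneg t
  have h2 : (2 : ℝ) ≤ Real.exp 1 := by linarith [Real.add_one_le_exp (1 : ℝ)]
  calc (2 : ℝ) ^ ⌊D * Real.log t⌋₊ ≤ Real.exp 1 ^ ⌊D * Real.log t⌋₊ :=
        pow_le_pow_left₀ (by norm_num) h2 _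
    _ = Real.exp ⌊D * Real.log t⌋₊ := by rw [← Real.exp_nat_mul, mul_one]
    _ ≤ Real.exp (D * Real.log t) := Real.exp_le_exp.2 (Nat.floor_le (by positivity))
    _ = (t : ℝ) ^ D := by rw [Real.exp_nat_mul, Real.exp_log ht0]

theorem exists_pow_mul_pow_half_le (k : ℕ) {q : ℝ} (hq0 : 0 ≤ q) (hq1 : q < 1) :
    ∃ C : ℝ, 0 ≤ C ∧ ∀ t : ℕ, 1 ≤ t → (t : ℝ) ^ k * q ^ (t - t / 2) ≤ C / (t : ℝ) ^ 3 := by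
  set r := Real.sqrt q with hr
  have hr0 : 0 ≤ r := Real.sqrt_nonneg _
  have hr1 : r < 1 := by rw [hr, Real.sqrt_lt' one_pos]; simpa
  obtain ⟨C, hC⟩ := (tendsto_pow_const_mul_const_pow_of_abs_lt_one (k + 3)
    (by rwa [abs_of_nonneg hr0])).bddAbove_range
  have hC' : ∀ t : ℕ, (t : ℝ) ^ (k + 3) * r ^ t ≤ C := fun t => hC ⟨t, rfl⟩
  refine ⟨C, le_trans (by positivity) (hC' 0), fun t ht => ?_⟩
  have ht0 : (0 : ℝ) < t := by exact_mod_cast ht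
  rw [le_div_iff₀ (by positivity)]
  have hqr : q ^ (t - t / 2) ≤ r ^ t := by
    rw [← Real.sq_sqrt hq0, ← pow_mul]
    exact pow_le_pow_of_le_one hr0 hr1.le (by omega)
  calc (t : ℝ) ^ k * q ^ (t - t / 2) * (t : ℝ) ^ 3
      = (t : ℝ) ^ (k + 3) * q ^ (t - t / 2) := by ring
    _ ≤ (t : ℝ) ^ (k + 3) * r ^ t := by gcongr
    _ ≤ C := hC' t

section Regret

variable {K : ℕ} {μ p : Fin K → ℝ} {last : Fin K} {ε δ : ℝ} {D : ℕ}

theorem IsSeparated.rate_mem (hs : IsSeparated μ p last ε δ D) :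
    0 ≤ 1 - ε ^ K / 2 ∧ 1 - ε ^ K / 2 < 1 := by
  have h1 := pow_pos hs.eps_pos K
  have h2 : ε ^ K ≤ 1 := pow_le_one₀ hs.eps_pos.le hs.eps_le_one
  constructor <;> linarith

theorem IsLCB.measureReal_count_le_log {Ω : Type*} [MeasurableSpace Ω] {P : Measure Ω}
    [IsProbabilityMeasure P] {ℱ : Filtration ℕ ‹MeasurableSpace Ω›} {X Y : Fin K → ℕ → Ω → Bool}
    {L : ℕ → Ω → Ordering K} (hE : IsEnvironment P ℱ μ p X Y) (hL : IsLCB X Y L ℱ)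
    (hs : IsSeparated μ p last ε δ D) (j : Fin K) {t n : ℕ} (ht : 1 ≤ t) (hn : t - t / 2 ≤ n) :
    P.real {ω | n ≤ ((Finset.range t).filter fun s => last ∉ preceding (L (s + 1) ω) j).card ∧
      (count X L j t ω : ℝ) ≤ D * Real.log t} ≤ (t : ℝ) ^ D * (1 - ε ^ K / 2) ^ (t - t / 2) := by
  refine le_trans (measureReal_mono (fun ω hω => ?_) (measure_ne_top _ _))
    ((hL.measureReal_count_le hE hs j t n ⌊D * Real.log t⌋₊).trans ?_)
  · exact ⟨hω.1, Nat.le_floor hω.2⟩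
  · exact mul_le_mul (two_pow_floor_mul_log_le D ht)
      (pow_le_pow_of_le_one hs.rate_mem.1 hs.rate_mem.2.le hn)
      (pow_nonneg hs.rate_mem.1 _) (by positivity)

theorem exists_measureReal_isBad_le (hμ : ∀ i, 0 < μ i) (hs : IsSeparated μ p last ε δ D) :
    ∃ C : ℝ, 0 ≤ C ∧ ∀ (Ω : Type*) [mΩ : MeasurableSpace Ω] (P : Measure Ω)
      [IsProbabilityMeasure P] (ℱ : Filtration ℕ mΩ) (X Y : Fin K → ℕ → Ω → Bool)
      (L : ℕ → Ω → Ordering K), IsEnvironment P ℱ μ p X Y → IsLCB X Y L ℱ →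
      ∀ t : ℕ, 1 ≤ t → P.real {ω | IsBad p X Y L last D t ω} ≤ C / (t : ℝ) ^ 3 := by
  obtain ⟨hq0, hq1⟩ := hs.rate_mem
  obtain ⟨C₀, hC₀, h₀⟩ := exists_pow_mul_pow_half_le 0 hq0 hq1
  obtain ⟨C₁, hC₁, h₁⟩ := exists_pow_mul_pow_half_le D hq0 hq1
  refine ⟨2 ^ K * C₀ + (K * 2 + C₁), by positivity, ?_⟩
  intro Ω mΩ P _ ℱ X Y L hE hL t ht
  have hunseen : P.real {ω | ∃ i, count X L i t ω = 0} ≤ 2 ^ K * (C₀ / (t : ℝ) ^ 3) := by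
    refine (hL.measureReal_unseen_le hE hs t).trans (mul_le_mul_of_nonneg_left ?_ (by positivity))
    refine le_trans ?_ (h₀ t ht)
    rw [pow_zero, one_mul]
    exact pow_le_pow_of_le_one hq0 hq1.le (Nat.sub_le _ _)
  have hdev : P.real {ω | ∃ i, Deviates p X Y L i t ω} ≤ K * (2 / (t : ℝ) ^ 3) := by
    have : {ω | ∃ i, Deviates p X Y L i t ω} = ⋃ i, {ω | Deviates p X Y L i t ω} := by
      ext ω; simp
    rw [this]
    refine (measureReal_iUnion_fintype_le _).trans ?_
    refine (Finset.sum_le_sum fun i _ => hL.measureReal_deviates_le hE hμ i ht).trans_eq ?_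
    simp
  have hlast : P.real {ω | (count X L last t ω : ℝ) ≤ D * Real.log t} ≤ C₁ / (t : ℝ) ^ 3 := by
    refine le_trans (measureReal_mono (fun ω hω => ?_) (measure_ne_top _ _))
      ((hL.measureReal_count_le_log hE hs last ht (Nat.sub_le t (t / 2))).trans (h₁ t ht))
    refine ⟨?_, hω⟩
    rw [Finset.filter_true_of_mem fun s _ => notMem_preceding _ _, Finset.card_range]
  have hsplit : {ω | IsBad p X Y L last D t ω} = {ω | ∃ i, count X L i t ω = 0} ∪
      ({ω | ∃ i, Deviates p X Y L i t ω} ∪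
        {ω | (count X L last t ω : ℝ) ≤ D * Real.log t}) := rfl
  rw [hsplit, add_div, add_div, mul_div_assoc, mul_div_assoc]
  exact (measureReal_union_le _ _).trans (add_le_add hunseen
    ((measureReal_union_le _ _).trans (add_le_add hdev hlast)))

theorem exists_measureReal_ne_refl_le (hμ : ∀ i, 0 < μ i) (hs : IsSeparated μ p last ε δ D) :
    ∃ C : ℝ, ∀ (Ω : Type*) [mΩ : MeasurableSpace Ω] (P : Measure Ω)
      [IsProbabilityMeasure P] (ℱ : Filtration ℕ mΩ) (X Y : Fin K → ℕ → Ω → Bool)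
      (L : ℕ → Ω → Ordering K), IsEnvironment P ℱ μ p X Y → IsLCB X Y L ℱ →
      ∀ t : ℕ, P.real {ω | L (t + 1) ω ≠ Equiv.refl (Fin K)} ≤ C / ((t : ℝ) + 1) ^ 2 := by
  obtain ⟨C₁, hC₁, h₁⟩ := exists_measureReal_isBad_le hμ hs
  obtain ⟨hq0, hq1⟩ := hs.rate_mem
  obtain ⟨C₂, hC₂, h₂⟩ := exists_pow_mul_pow_half_le D hq0 hq1
  set C₃ := C₁ + K * (27 * C₁ + C₂) with hC₃
  have hC₃0 : 0 ≤ C₃ := by positivity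
  refine ⟨4 * C₃ + 4, ?_⟩
  intro Ω mΩ P _ ℱ X Y L hE hL t
  rcases Nat.lt_or_ge t 2 with ht | ht
  · refine measureReal_le_one.trans ?_
    rw [le_div_iff₀ (by positivity), one_mul]
    have : (t : ℝ) ≤ 1 := by exact_mod_cast Nat.lt_succ_iff.1 ht
    have h0 : (0 : ℝ) ≤ t := t.cast_nonneg
    nlinarith
  have ht2 : (2 : ℝ) ≤ t := by exact_mod_cast ht
  have ht0 : (0 : ℝ) < t := by linarith
  have hcube : ∀ C : ℝ, 0 ≤ C → C / (t : ℝ) ^ 3 ≤ C / (t : ℝ) ^ 2 := fun C hC =>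
    div_le_div_of_nonneg_left hC (by positivity)
      (pow_le_pow_right₀ (by linarith) (by norm_num))
  have hcount : ∀ j, P.real {ω | (count X L j t ω : ℝ) ≤ D * Real.log t} ≤
      27 * C₁ / (t : ℝ) ^ 2 + C₂ / (t : ℝ) ^ 2 := by
    intro j
    have hsub : {ω | (count X L j t ω : ℝ) ≤ D * Real.log t} ⊆
        (⋃ s ∈ Finset.Ico (t / 2) t, {ω | IsBad p X Y L last D s ω}) ∪
        {ω | t - t / 2 ≤
          ((Finset.range t).filter fun s => last ∉ preceding (L (s + 1) ω) j).card ∧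
          (count X L j t ω : ℝ) ≤ D * Real.log t} := by
      intro ω hω
      by_cases hb : ∃ s ∈ Finset.Ico (t / 2) t, IsBad p X Y L last D s ω
      · obtain ⟨s, hst, hbad⟩ := hb
        exact Or.inl (Set.mem_biUnion hst hbad)
      · refine Or.inr ⟨?_, hω⟩
        rw [← Nat.card_Ico]
        refine Finset.card_le_card fun s hst => ?_
        rw [Finset.mem_filter, Finset.mem_range]
        exact ⟨(Finset.mem_Ico.1 hst).2,
          hL.last_notMem_preceding hs (fun hbad => hb ⟨s, hst, hbad⟩) j⟩
    refine le_trans (measureReal_mono hsub (measure_ne_top _ _))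
      ((measureReal_union_le _ _).trans (add_le_add ?_ ?_))
    · calc P.real (⋃ s ∈ Finset.Ico (t / 2) t, {ω | IsBad p X Y L last D s ω})
          ≤ ∑ s ∈ Finset.Ico (t / 2) t, P.real {ω | IsBad p X Y L last D s ω} :=
            measureReal_biUnion_finset_le _ _
        _ ≤ ∑ s ∈ Finset.Ico (t / 2) t, 27 * C₁ / (t : ℝ) ^ 3 := by
            refine Finset.sum_le_sum fun s hst => ?_
            have hst' := (Finset.mem_Ico.1 hst).1
            have h3 : (t : ℝ) ≤ 3 * s := by exact_mod_cast (by omega : t ≤ 3 * s)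
            have hs0 : (0 : ℝ) < s := by linarith
            refine (h₁ Ω P ℱ X Y L hE hL s (by omega)).trans ?_
            rw [div_le_div_iff₀ (by positivity) (by positivity)]
            have := pow_le_pow_left₀ ht0.le h3 3
            nlinarith [mul_le_mul_of_nonneg_left this hC₁]
        _ ≤ t * (27 * C₁ / (t : ℝ) ^ 3) := by
            rw [Finset.sum_const, Nat.card_Ico, nsmul_eq_mul]
            refine mul_le_mul_of_nonneg_right ?_ (by positivity)
            exact_mod_cast Nat.sub_le _ _
        _ = 27 * C₁ / (t : ℝ) ^ 2 := by field_simp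
    · exact ((hL.measureReal_count_le_log hE hs j (by omega) le_rfl).trans
        (h₂ t (by omega))).trans (hcube C₂ hC₂)
  have hsub : {ω | L (t + 1) ω ≠ Equiv.refl (Fin K)} ⊆ {ω | IsBad p X Y L last D t ω} ∪
      ⋃ j, {ω | (count X L j t ω : ℝ) ≤ D * Real.log t} := by
    intro ω hω
    by_contra hc
    simp only [Set.mem_union, Set.mem_iUnion, Set.mem_ofPred_eq, not_or, not_exists, not_le] at hc
    exact hω (hL.eq_refl hs hc.1 hc.2)
  calc P.real {ω | L (t + 1) ω ≠ Equiv.refl (Fin K)}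
      ≤ C₁ / (t : ℝ) ^ 2 + K * (27 * C₁ / (t : ℝ) ^ 2 + C₂ / (t : ℝ) ^ 2) := by
        refine le_trans (measureReal_mono hsub (measure_ne_top _ _))
          ((measureReal_union_le _ _).trans (add_le_add ?_ ?_))
        · exact (h₁ Ω P ℱ X Y L hE hL t (by omega)).trans (hcube C₁ hC₁)
        · refine (measureReal_iUnion_fintype_le _).trans ?_
          refine (Finset.sum_le_sum fun j _ => hcount j).trans_eq ?_
          rw [Finset.sum_const, Finset.card_univ, Fintype.card_fin, nsmul_eq_mul]
    _ = 4 * C₃ / (2 * (t : ℝ)) ^ 2 := by rw [hC₃]; field_simp; ring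
    _ ≤ (4 * C₃ + 4) / (2 * (t : ℝ)) ^ 2 := by gcongr; linarith
    _ ≤ (4 * C₃ + 4) / ((t : ℝ) + 1) ^ 2 := by gcongr; linarith

/-- The regret is controlled by the probabilities of not playing the optimal ordering. -/
theorem exists_abs_regret_le (μ p : Fin K → ℝ) :
    ∃ M : ℝ, 0 ≤ M ∧ ∀ (Ω : Type*) [MeasurableSpace Ω] (P : Measure Ω)
      [IsProbabilityMeasure P] (L : ℕ → Ω → Ordering K),
      (∀ t, MeasurableSet {ω | L (t + 1) ω ≠ Equiv.refl (Fin K)}) →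
      ∀ T : ℕ, |regret P μ p L T| ≤
        ∑ t ∈ Finset.range T, M * P.real {ω | L (t + 1) ω ≠ Equiv.refl (Fin K)} := by
  let M : ℝ := ∑ σ : Ordering K, |reward μ p (Equiv.refl (Fin K)) - reward μ p σ|
  refine ⟨M, Finset.sum_nonneg fun _ _ => abs_nonneg _, ?_⟩
  intro Ω _ P _ L hmeas T
  have hregret : regret P μ p L T = ∑ t ∈ Finset.range T,
      ∫ ω, (reward μ p (Equiv.refl (Fin K)) - reward μ p (L (t + 1) ω)) ∂P := by
    rw [regret]
    induction T with
    | zero => simp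
    | succ T ih => rw [Finset.sum_Icc_succ_top (by omega), Finset.sum_range_succ, ih]
  rw [hregret]
  refine (Finset.abs_sum_le_sum_abs _ _).trans (Finset.sum_le_sum fun t _ => ?_)
  have h := norm_integral_le_of_norm_le (μ := P)
    (f := fun ω => reward μ p (Equiv.refl (Fin K)) - reward μ p (L (t + 1) ω))
    ((integrable_const M).indicator (hmeas t)) (.of_forall fun ω => ?_)
  · rw [integral_indicator_const _ (hmeas t), smul_eq_mul, mul_comm] at h
    exact h
  · by_cases hω : L (t + 1) ω = Equiv.refl (Fin K)
    · simp [hω]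
    · rw [Set.indicator_of_mem (by exact hω), Real.norm_eq_abs]
      exact Finset.single_le_sum
        (f := fun σ => |reward μ p (Equiv.refl (Fin K)) - reward μ p σ|)
        (fun _ _ => abs_nonneg _) (Finset.mem_univ (L (t + 1) ω))

end Regret

/-- A finite family of positive reals has a positive lower bound, which may be taken at most one. -/
theorem exists_pos_le_of_finite {ι : Type*} [Finite ι] (f : ι → ℝ) (hf : ∀ i, 0 < f i) :
    ∃ e : ℝ, 0 < e ∧ e ≤ 1 ∧ ∀ i, e ≤ f i := by
  cases nonempty_fintype ι
  rcases isEmpty_or_nonempty ι with _ | _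
  · exact ⟨1, one_pos, le_rfl, isEmptyElim⟩
  · obtain ⟨i, hi⟩ := Finite.exists_min f
    exact ⟨min 1 (f i), lt_min one_pos (hf i), min_le_left _ _,
      fun j => (min_le_right _ _).trans (hi j)⟩

theorem exists_isSeparated {K : ℕ} {μ p : Fin K → ℝ} (hμ_pos : ∀ i, 0 < μ i)
    (hμ_lt : ∀ i j, i < j → μ i < 1) (hp : StrictMono p) {last : Fin K} (hlast : ∀ j, j ≤ last) :
    ∃ (ε δ : ℝ) (D : ℕ), IsSeparated μ p last ε δ D := by
  obtain ⟨ε₁, h10, h11, h1⟩ := exists_pos_le_of_finite μ hμ_pos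
  obtain ⟨ε₂, h20, -, h2⟩ := exists_pos_le_of_finite
    (fun j : {j : Fin K // j ≠ last} => 1 - μ j)
    fun j => sub_pos.2 (hμ_lt j last (lt_of_le_of_ne (hlast j) j.2))
  obtain ⟨δ, hδ0, -, hδ⟩ := exists_pos_le_of_finite
    (fun x : {x : Fin K × Fin K // x.1 < x.2} => p x.1.2 - p x.1.1)
    fun x => sub_pos.2 (hp x.2)
  obtain ⟨D, hD⟩ := exists_nat_ge (8 / δ ^ 2)
  exact ⟨min ε₁ ε₂, δ, D, {
    le_last := hlast
    eps_pos := lt_min h10 h20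
    eps_le_one := (min_le_left _ _).trans h11
    eps_le := fun i => (min_le_left _ _).trans (h1 i)
    eps_le_one_sub := fun j hj => (min_le_right _ _).trans (h2 ⟨j, hj⟩)
    delta_pos := hδ0
    add_delta_le := fun i j hij => by linarith [hδ ⟨(i, j), hij⟩]
    eight_le := (div_le_iff₀ (pow_pos hδ0 2)).1 hD }⟩

end CascadeBandit

theorem mainTheorem1 (K : ℕ) (μ p : Fin K → ℝ)
    (hμ_pos : ∀ i, 0 < μ i) (hμ_lt : ∀ i j, i < j → μ i < 1) (hp : StrictMono p) :
    ∃ C : ℝ, ∀ (Ω : Type*) [mΩ : MeasurableSpace Ω] (P : MeasureTheory.Measure Ω)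
      [MeasureTheory.IsProbabilityMeasure P] (ℱ : MeasureTheory.Filtration ℕ mΩ)
      (X Y : Fin K → ℕ → Ω → Bool) (L : ℕ → Ω → CascadeBandit.Ordering K),
      CascadeBandit.IsEnvironment P ℱ μ p X Y → CascadeBandit.IsLCB X Y L ℱ →
      ∀ T : ℕ, |CascadeBandit.regret P μ p L T| ≤ C := by
  rcases K with _ | k
  · refine ⟨0, fun Ω _ P _ ℱ X Y L _ _ T => ?_⟩
    simp [CascadeBandit.regret, CascadeBandit.reward]
  obtain ⟨ε, δ, D, hs⟩ :=
    CascadeBandit.exists_isSeparated hμ_pos hμ_lt hp (last := Fin.last k) Fin.le_last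
  obtain ⟨C, hC⟩ := CascadeBandit.exists_measureReal_ne_refl_le hμ_pos hs
  obtain ⟨M, hM0, hM⟩ := CascadeBandit.exists_abs_regret_le μ p
  have hsum : Summable fun t : ℕ => M * (C / ((t : ℝ) + 1) ^ 2) := by
    have := ((summable_nat_add_iff 1).2
      (Real.summable_one_div_nat_pow.2 (by norm_num : 1 < 2))).mul_left (M * C)
    refine this.congr fun t => ?_
    push_cast
    ring
  refine ⟨∑' t : ℕ, M * (C / ((t : ℝ) + 1) ^ 2), fun Ω mΩ P _ ℱ X Y L hE hL T => ?_⟩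
  have hbound := hC Ω P ℱ X Y L hE hL
  refine (hM Ω P L (fun t => (ℱ.le t _ (hL.predictable t _)).compl) T).trans ?_
  refine (Finset.sum_le_sum fun t _ => mul_le_mul_of_nonneg_left (hbound t) hM0).trans ?_
  exact hsum.sum_le_tsum _ fun t _ => mul_nonneg hM0 (MeasureTheory.measureReal_nonneg.trans (hbound t))
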